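/- Let $d\ge 1$, $n\ge 1$, and let $l=(l_1,\dots,l_d)$, $u=(u_1,\dots,u_d)$ be vectors of integers with $1\le l_i<u_i\le n$ for all $i$ and $2\le u_{i+1}\le u_i-l_i-1$ for $i=1,\dots,d-1$. Let $\{g_X(\cdot;\theta):\theta\in\Theta\}$ be a family of probability densities on $\mathbb R^d$, and let $\boldsymbol X=(X^{(1)},\dots,X^{(n)})$ have joint density $g_{\boldsymbol X}(\boldsymbol x;\theta)=\prod_{k=1}^n g_X(x^{(k)};\theta)$. The sequentially nested random rectangle $S=(S_l,S_u,n)$, $S_l=(S_{l,1},\dots,S_{l,d})$, $S_u=(S_{u,1},\dots,S_{u,d})$, is defined recursively: for $i=1,\dots,d$, $S_{l,i}$ and $S_{u,i}$ are the $l_i$-th and $u_i$-th order statistics of the $i$-th coordinates of those sample points whose $j$-th coordinate lies in $(S_{l,j},S_{u,j})$ for every $j<i$ (all $n$ points if $i=1$). The symbolic likelihood function $L(s;\theta)$ is $\int f_{S\mid\boldsymbol X=\boldsymbol z}(s)\,g_{\boldsymbol X}(\boldsymbol z;\theta)\,d\boldsymbol z$, where the conditional law of $S$ given $\boldsymbol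 X=\boldsymbol z$ is the Dirac mass at the rectangle of $\boldsymbol z$; that is, $L(\cdot;\theta)$ is the Lebesgue density of $(S_l,S_u)$ on $\{(s_l,s_u): s_{l,i}\le s_{u,i}\ \forall i\}$. Let $X=(X_1,\dots,X_d)$ have density $g_X(\cdot;\theta)$ and write $\mathrm d\mathbb P(X_i<t)$ for the marginal density of $X_i$ at $t$. Then, with a positive constant of proportionality depending only on $d,n,l,u$ (not on $s$, $\theta$ or $g_X$), for almost every $s$, $$L(s;\theta)\propto \mathbb P(s_{l,i}<X_i<s_{u,i};\,1\le i\le d)^{u_d-l_d-1}\,\mathrm d\mathbb P(X_1<s_{l,1})\,\mathrm d\mathbb P(X_1<s_{u,1})\prod_{i=1}^d p_i(s_l)\,q_i(s_u),$$ where $p_1(s_l)=\mathbb P(X_1<s_{l,1})^{l_1-1}$, $q_1(s_u)=\mathbb P(X_1>s_{u,1})^{n-u_1}$ and, for $i=2,\dots,d$, $$p_i(s_l)=\mathbb P(s_{l,j}<X_j<s_{u,j};\,j<i\mid X_i=s_{l,i})\;\mathrm d\mathbb P(X_i<s_{l,i})\;\mathbb P(X_i<s_{l,i},\ s_{l,j}<X_j<s_{u,j};\,j<i)^{l_i-1},$$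 $$q_i(s_u)=\mathbb P(s_{l,j}<X_j<s_{u,j};\,j<i\mid X_i=s_{u,i})\;\mathrm d\mathbb P(X_i<s_{u,i})\;\mathbb P(X_i>s_{u,i},\ s_{l,j}<X_j<s_{u,j};\,j<i)^{u_{i-1}-u_i-l_{i-1}-1}.$$ -/

import Mathlib

open MeasureTheory ProbabilityTheory
open scoped ENNReal NNReal

noncomputable section

/-- The `k`-th order statistic (`k = 1` is the minimum) of the values `v m`, `m ∈ A`, counted with
multiplicity: the smallest `t` such that at least `k` of these values are at most `t`. -/
def orderStat {ι : Type*} (A : Finset ι) (v : ι → ℝ) (k : ℕ) : ℝ :=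
  sInf {t : ℝ | k ≤ (A.filter (fun m => v m ≤ t)).card}

/-- Sequential nesting: `nestedIdx l u x k` is the set of (indices of) those points of the sample
`x` that lie strictly inside the random rectangle in each of the first `k` coordinates. The two
bounds in the next coordinate are the order statistics of ranks `l` and `u` of that coordinate,
taken among these points only. -/
def nestedIdx {d n : ℕ} (l u : Fin d → ℕ) (x : Fin n → Fin d → ℝ) : ℕ → Finset (Fin n)
  | 0 => Finset.univ
  | k + 1 =>
    if h : k < d then
      (nestedIdx l u x k).filter (fun m =>
        orderStat (nestedIdx l u x k) (fun r => x r ⟨k, h⟩) (l ⟨k, h⟩) < x m ⟨k, h⟩ ∧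
        x m ⟨k, h⟩ < orderStat (nestedIdx l u x k) (fun r => x r ⟨k, h⟩) (u ⟨k, h⟩))
    else nestedIdx l u x k

/-- The sequentially nested random rectangle `(s_l, s_u)` of the sample `x` of size `n`. -/
def seqNest {d n : ℕ} (l u : Fin d → ℕ) (x : Fin n → Fin d → ℝ) :
    (Fin d → ℝ) × (Fin d → ℝ) :=
  (fun i => orderStat (nestedIdx l u x i) (fun r => x r i) (l i),
   fun i => orderStat (nestedIdx l u x i) (fun r => x r i) (u i))

/-- The space of `d`-dimensional rectangles: pairs `(s_l, s_u)` with `s_l ≤ s_u` coordinatewise. -/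
def rectSpace (d : ℕ) : Set ((Fin d → ℝ) × (Fin d → ℝ)) :=
  {s | ∀ i, s.1 i ≤ s.2 i}

/-- `L` is the symbolic likelihood function, on the symbol space `T`, of the symbol `agg z`
aggregated from data `z` with joint density `gX`:
`L(s) = ∫ f_{S | X = z}(s) gX(z) dz`, where the conditional law of the symbol given the data `z` is
the Dirac mass at `agg z`. As that law has no density, the identity is between densities, i.e. it
is integrated over every measurable set `B` of symbols. -/
def IsSymbolicLikelihood {𝒳 𝒮 : Type*} [MeasureSpace 𝒳] [MeasureSpace 𝒮] (agg : 𝒳 → 𝒮)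
    (T : Set 𝒮) (gX : 𝒳 → ℝ≥0∞) (L : 𝒮 → ℝ≥0∞) : Prop :=
  Measurable L ∧ ∀ B : Set 𝒮, MeasurableSet B →
    ∫⁻ s in B ∩ T, L s = ∫⁻ z, Measure.dirac (agg z) B * gX z

section Formula

variable {d : ℕ} (μ : Measure (Fin d → ℝ))

/-- The event `s_{l,j} < X_j < s_{u,j}` for all `j < i`. -/
def earlierBox (s : (Fin d → ℝ) × (Fin d → ℝ)) (i : Fin d) : Set (Fin d → ℝ) :=
  {x | ∀ j < i, s.1 j < x j ∧ x j < s.2 j}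

/-- The marginal density `dP(X_i < t)` at `t` of the `i`-th coordinate of `X`, where `X` has
law `μ`. -/
def margDens (i : Fin d) (t : ℝ) : ℝ≥0∞ :=
  pdf (fun x : Fin d → ℝ => x i) μ volume t

/-- The conditional probability `P(s_{l,j} < X_j < s_{u,j}; j < i | X_i = t)`, where `X` has
law `μ`. -/
def condEarlier [IsFiniteMeasure μ] (s : (Fin d → ℝ) × (Fin d → ℝ)) (i : Fin d) (t : ℝ) : ℝ≥0∞ :=
  condDistrib (fun x : Fin d → ℝ => x) (fun x : Fin d → ℝ => x i) μ t (earlierBox s i)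

/-- The factor `p_i(s_l)`. -/
def pTerm [NeZero d] [IsFiniteMeasure μ] (l : Fin d → ℕ)
    (s : (Fin d → ℝ) × (Fin d → ℝ)) (i : Fin d) : ℝ≥0∞ :=
  if i = 0 then μ {x | x 0 < s.1 0} ^ (l 0 - 1)
  else condEarlier μ s i (s.1 i) * margDens μ i (s.1 i) *
    μ ({x | x i < s.1 i} ∩ earlierBox s i) ^ (l i - 1)

/-- The factor `q_i(s_u)`. For `i ≠ 0`, `i - 1` is the preceding coordinate. -/
def qTerm [NeZero d] [IsFiniteMeasure μ] (n : ℕ) (l u : Fin d → ℕ)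
    (s : (Fin d → ℝ) × (Fin d → ℝ)) (i : Fin d) : ℝ≥0∞ :=
  if i = 0 then μ {x | s.2 0 < x 0} ^ (n - u 0)
  else condEarlier μ s i (s.2 i) * margDens μ i (s.2 i) *
    μ ({x | s.2 i < x i} ∩ earlierBox s i) ^ (u (i - 1) - u i - l (i - 1) - 1)

/-- The sequential-nesting likelihood, without the normalising constant; `⊤ : Fin d` is the last
coordinate and `0 : Fin d` the first one. -/
def seqNestLik [NeZero d] [IsFiniteMeasure μ] (n : ℕ) (l u : Fin d → ℕ)
    (s : (Fin d → ℝ) × (Fin d → ℝ)) : ℝ≥0∞ :=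
  μ {x | ∀ i, s.1 i < x i ∧ x i < s.2 i} ^ (u ⊤ - l ⊤ - 1) *
    margDens μ 0 (s.1 0) * margDens μ 0 (s.2 0) *
    ∏ i : Fin d, pTerm μ l s i * qTerm μ n l u s i

end Formula

end

/-! A nondegenerate rectangle cuts space into disjoint cells: for each coordinate, two faces and two
outer pieces confined to the box of the earlier coordinates, plus the open interior. For a sample
without ties in any coordinate, hence for almost every sample, a rectangle is the nested one exactly
when each cell holds its prescribed number of points, one on each face (`HasCellCounts.seqNest_eq`,
`hasCellCounts_seqNest`).

So the event that the nested rectangle lies in `B` splits, up to a null set, over the labelings of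
points by cells with these counts (`sum_indicator_fitSet`). The points are i.i.d., so all labelings
contribute equally, and their number is the constant.

For one labeling, the `2 * d` face points determine the rectangle; the other points integrate out to
powers of cell probabilities (`pi_fitSet_eq_lintegral`). Each face point is then disintegrated along
the coordinate orthogonal to its face (`lintegral_pi_condDistrib`): that coordinate gives a marginal
density, and the conditional law gives the probability of the earlier box. The product is the stated
likelihood (`seqNestLik_rectOf`, `pi_fitSet`). -/

noncomputable section

/-! ### Order statistics through counting -/

section OrderStatistics

variable {ι : Type*} {A : Finset ι} {v : ι → ℝ} {k : ℕ}

theorem orderStat_eq_of_card {t : ℝ} (h1 : (A.filter (fun m => v m < t)).card < k)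
    (h2 : k ≤ (A.filter (fun m => v m ≤ t)).card) : orderStat A v k = t := by
  refine IsLeast.csInf_eq ⟨h2, fun a ha => ?_⟩
  by_contra! hlt
  refine absurd (le_trans (show k ≤ _ from ha) (Finset.card_le_card ?_)) (not_le.2 h1)
  exact Finset.monotone_filter_right A fun m _ hm => lt_of_le_of_lt hm hlt

theorem card_filter_le_eq_add (A : Finset ι) (v : ι → ℝ) (t : ℝ) :
    (A.filter (fun m => v m ≤ t)).card =
      (A.filter (fun m => v m < t)).card + (A.filter (fun m => v m = t)).card := by
  classical
  rw [← Finset.card_union_of_disjoint, ← Finset.filter_or]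
  · simp only [le_iff_lt_or_eq]
  · exact Finset.disjoint_filter.2 fun m _ h => h.ne

theorem card_eq_add_filter (A : Finset ι) (v : ι → ℝ) (t : ℝ) :
    A.card = (A.filter (fun m => v m < t)).card + (A.filter (fun m => v m = t)).card +
      (A.filter (fun m => t < v m)).card := by
  rw [← card_filter_le_eq_add, ← Finset.card_filter_add_card_filter_not (fun m => v m ≤ t)]
  simp only [not_le]

theorem filter_filter_of_imp (A : Finset ι) {p q : ι → Prop} [DecidablePred p] [DecidablePred q]
    (h : ∀ m, q m → p m) : (A.filter p).filter q = A.filter q := by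
  rw [Finset.filter_filter]
  exact Finset.filter_congr fun m _ => ⟨fun hm => hm.2, fun hm => ⟨h m hm, hm⟩⟩

/-- Without ties the order statistic is attained, at the smallest value having at least `k` values
at or below it. -/
theorem exists_eq_orderStat (hv : Set.InjOn v A) (hk : 1 ≤ k) (hkA : k ≤ A.card) :
    (A.filter (fun m => v m < orderStat A v k)).card = k - 1 ∧
      (A.filter (fun m => v m = orderStat A v k)).card = 1 := by
  classical
  have one (m) (hm : m ∈ A) : (A.filter (fun r => v r = v m)).card = 1 := by
    rw [Finset.card_eq_one]
    exact ⟨m, by ext r; simp only [Finset.mem_filter, Finset.mem_singleton]; exact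
      ⟨fun h => hv h.1 hm h.2, by rintro rfl; exact ⟨hm, rfl⟩⟩⟩
  obtain ⟨M, hM, hMmax⟩ := A.exists_max_image v (Finset.card_pos.1 (by omega))
  obtain ⟨m, hm, hmin⟩ := (A.filter (fun m => k ≤ (A.filter (fun r => v r ≤ v m)).card)
    ).exists_min_image v ⟨M, Finset.mem_filter.2 ⟨hM, by
      rwa [Finset.filter_true_of_mem hMmax]⟩⟩
  obtain ⟨hmA, hmk⟩ := Finset.mem_filter.1 hm
  -- If `k` values lay strictly below `v m`, the largest of them would be a smaller candidate.
  have hlt : (A.filter (fun r => v r < v m)).card < k := by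
    by_contra! hge
    obtain ⟨b, hb, hbmax⟩ := (A.filter (fun r => v r < v m)).exists_max_image v
      (Finset.card_pos.1 (by omega))
    obtain ⟨hbA, hbm⟩ := Finset.mem_filter.1 hb
    refine absurd (hmin b (Finset.mem_filter.2 ⟨hbA, hge.trans (Finset.card_le_card ?_)⟩))
      (not_le.2 hbm)
    intro r hr
    exact Finset.mem_filter.2 ⟨(Finset.mem_filter.1 hr).1, hbmax r hr⟩
  rw [orderStat_eq_of_card hlt hmk]
  have := card_filter_le_eq_add A v (v m)
  rw [one m hmA] at this
  exact ⟨by omega, one m hmA⟩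

end OrderStatistics

/-! ### Cells of a rectangle and their point counts -/

section Cells

variable {d n : ℕ}

/-- The `2 * d` faces of a rectangle: `inl i` is the lower and `inr i` the upper `i`-th face. -/
abbrev Face (d : ℕ) : Type := Fin d ⊕ Fin d

/-- The labels of the pieces into which a rectangle cuts the space: the two faces met at each
stage, the two open outer pieces of each stage, and the interior. -/
abbrev CellLabel (d : ℕ) : Type := Face d ⊕ Option (Face d)

/-- The piece of the space with a given label. -/
def cell (s : (Fin d → ℝ) × (Fin d → ℝ)) : CellLabel d → Set (Fin d → ℝ)
  | .inl (.inl i) => {x | x i = s.1 i} ∩ earlierBox s i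
  | .inl (.inr i) => {x | x i = s.2 i} ∩ earlierBox s i
  | .inr none => {x | ∀ i, s.1 i < x i ∧ x i < s.2 i}
  | .inr (some (.inl i)) => {x | x i < s.1 i} ∩ earlierBox s i
  | .inr (some (.inr i)) => {x | s.2 i < x i} ∩ earlierBox s i

/-- A cell other than the interior records the first coordinate in which `x` leaves the open
rectangle, so `x` determines the stage (`key`); nondegeneracy separates the four cells of one stage.
-/
theorem cell_unique {s : (Fin d → ℝ) × (Fin d → ℝ)} (hs : ∀ i, s.1 i < s.2 i) {x : Fin d → ℝ}
    {a b : CellLabel d} (ha : x ∈ cell s a) (hb : x ∈ cell s b) : a = b := by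
  have key (i j : Fin d) (hi : x ∈ earlierBox s i) (hj : x ∈ earlierBox s j)
      (hi' : ¬ (s.1 i < x i ∧ x i < s.2 i)) (hj' : ¬ (s.1 j < x j ∧ x j < s.2 j)) : i = j := by
    rcases lt_trichotomy i j with h | h | h
    · exact absurd (hj i h) hi'
    · exact h
    · exact absurd (hi j h) hj'
  rcases a with (i | i) | _ | (i | i) <;> rcases b with (j | j) | _ | (j | j) <;>
    simp only [cell, Set.mem_inter_iff, Set.mem_ofPred_eq] at ha hb <;> grind

theorem exists_mem_cell (s : (Fin d → ℝ) × (Fin d → ℝ)) (x : Fin d → ℝ) :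
    ∃ a, x ∈ cell s a := by
  by_cases h : ∀ i, s.1 i < x i ∧ x i < s.2 i
  · exact ⟨.inr none, h⟩
  push Not at h
  classical
  have hne : (Finset.univ.filter (fun i => ¬ (s.1 i < x i ∧ x i < s.2 i))).Nonempty := by
    obtain ⟨i, hi⟩ := h
    exact ⟨i, by simpa using hi⟩
  obtain ⟨i, hi, hmin⟩ := Finset.exists_min_image _ id hne
  have hbox : x ∈ earlierBox s i := fun j hj => by
    by_contra hj'
    exact absurd (hmin j (by simpa using hj')) (not_le.2 hj)
  simp only [Finset.mem_filter, Finset.mem_univ, true_and] at hi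
  rcases lt_trichotomy (x i) (s.1 i) with h1 | h1 | h1
  · exact ⟨.inr (some (.inl i)), h1, hbox⟩
  · exact ⟨.inl (.inl i), h1, hbox⟩
  rcases lt_trichotomy (x i) (s.2 i) with h2 | h2 | h2
  · exact absurd ⟨h1, h2⟩ hi
  · exact ⟨.inl (.inr i), h2, hbox⟩
  · exact ⟨.inr (some (.inr i)), h2, hbox⟩

/-- The number of sample points left after `k` stages of sequential nesting. -/
def stageSize (n : ℕ) (l u : Fin d → ℕ) : ℕ → ℕ
  | 0 => n
  | k + 1 => if h : k < d then u ⟨k, h⟩ - l ⟨k, h⟩ - 1 else 0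

/-- The number of sample points in each open cell. -/
def openCount (n : ℕ) (l u : Fin d → ℕ) : Option (Face d) → ℕ
  | none => stageSize n l u d
  | some (.inl i) => l i - 1
  | some (.inr i) => stageSize n l u i - u i

/-- The number of sample points in each cell. -/
def cellCount (n : ℕ) (l u : Fin d → ℕ) : CellLabel d → ℕ
  | .inl _ => 1
  | .inr a => openCount n l u a

/-- The indices of the sample points inside the rectangle `s` in the first `k` coordinates. -/
def boxIdx (s : (Fin d → ℝ) × (Fin d → ℝ)) (z : Fin n → Fin d → ℝ) (k : ℕ) : Finset (Fin n) :=
  Finset.univ.filter fun m => ∀ j : Fin d, (j : ℕ) < k → s.1 j < z m j ∧ z m j < s.2 j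

/-- The indices of the sample points in a cell. -/
def cellIdx (s : (Fin d → ℝ) × (Fin d → ℝ)) (z : Fin n → Fin d → ℝ) (a : CellLabel d) :
    Finset (Fin n) := by
  classical exact Finset.univ.filter fun m => z m ∈ cell s a

/-- The rectangle `s` is nondegenerate and its cells hold the right numbers of sample points. -/
def HasCellCounts (l u : Fin d → ℕ) (z : Fin n → Fin d → ℝ)
    (s : (Fin d → ℝ) × (Fin d → ℝ)) : Prop :=
  (∀ i, s.1 i < s.2 i) ∧ ∀ a, (cellIdx s z a).card = cellCount n l u a

variable {l u : Fin d → ℕ} {z : Fin n → Fin d → ℝ} {s : (Fin d → ℝ) × (Fin d → ℝ)}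

theorem mem_boxIdx_iff {i : Fin d} {m : Fin n} : m ∈ boxIdx s z i ↔ z m ∈ earlierBox s i := by
  simp [boxIdx, earlierBox]

theorem mem_cellIdx_iff {a : CellLabel d} {m : Fin n} : m ∈ cellIdx s z a ↔ z m ∈ cell s a := by
  simp [cellIdx]

theorem boxIdx_zero : boxIdx s z 0 = Finset.univ := by simp [boxIdx]

theorem boxIdx_succ (i : Fin d) : boxIdx s z (i + 1) =
    (boxIdx s z i).filter fun m => s.1 i < z m i ∧ z m i < s.2 i := by
  ext m
  simp only [boxIdx, Finset.mem_filter, Finset.mem_univ, true_and, Nat.lt_succ_iff]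
  refine ⟨fun h => ⟨fun j hj => h j hj.le, h i le_rfl⟩, fun h j hj => ?_⟩
  rcases hj.lt_or_eq with hj | hj
  · exact h.1 j hj
  · obtain rfl := Fin.ext hj
    exact h.2

theorem nestedIdx_succ (i : Fin d) : nestedIdx l u z (i + 1) =
    (nestedIdx l u z i).filter fun m =>
      (seqNest l u z).1 i < z m i ∧ z m i < (seqNest l u z).2 i := by
  rw [nestedIdx, dif_pos i.2]
  rfl

theorem nestedIdx_eq_boxIdx (k : ℕ) (hk : k ≤ d) :
    nestedIdx l u z k = boxIdx (seqNest l u z) z k := by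
  induction k with
  | zero => rw [boxIdx_zero, nestedIdx]
  | succ k ih =>
    have h1 := nestedIdx_succ (l := l) (u := u) (z := z) ⟨k, hk⟩
    have h2 := boxIdx_succ (s := seqNest l u z) (z := z) ⟨k, hk⟩
    simp only at h1 h2
    rw [h1, h2, ih (by omega)]

theorem filter_boxIdx_lt (i : Fin d) :
    (boxIdx s z i).filter (fun m => z m i < s.1 i) = cellIdx s z (.inr (some (.inl i))) := by
  ext m
  rw [Finset.mem_filter, mem_boxIdx_iff, mem_cellIdx_iff, and_comm]
  rfl

theorem filter_boxIdx_eq (i : Fin d) :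
    (boxIdx s z i).filter (fun m => z m i = s.1 i) = cellIdx s z (.inl (.inl i)) := by
  ext m
  rw [Finset.mem_filter, mem_boxIdx_iff, mem_cellIdx_iff, and_comm]
  rfl

theorem filter_boxIdx_eq' (i : Fin d) :
    (boxIdx s z i).filter (fun m => z m i = s.2 i) = cellIdx s z (.inl (.inr i)) := by
  ext m
  rw [Finset.mem_filter, mem_boxIdx_iff, mem_cellIdx_iff, and_comm]
  rfl

theorem filter_boxIdx_gt (i : Fin d) :
    (boxIdx s z i).filter (fun m => s.2 i < z m i) = cellIdx s z (.inr (some (.inr i))) := by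
  ext m
  rw [Finset.mem_filter, mem_boxIdx_iff, mem_cellIdx_iff, and_comm]
  rfl

theorem boxIdx_last : boxIdx s z d = cellIdx s z (.inr none) := by
  ext m
  rw [mem_cellIdx_iff]
  simp [boxIdx, cell]

theorem card_filter_lt_eq_add (hs : ∀ i, s.1 i < s.2 i) (i : Fin d) :
    ((boxIdx s z i).filter (fun m => z m i < s.2 i)).card =
      (cellIdx s z (.inr (some (.inl i)))).card + (cellIdx s z (.inl (.inl i))).card +
        (boxIdx s z (i + 1)).card := by
  rw [card_eq_add_filter _ (fun m => z m i) (s.1 i), ← filter_boxIdx_lt, ← filter_boxIdx_eq,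
    boxIdx_succ]
  rw [filter_filter_of_imp _ fun m h => h.trans (hs i),
    filter_filter_of_imp _ fun m h => h.trans_lt (hs i), Finset.filter_filter]
  simp only [and_comm]

/-- The cells met at stage `i` and the next box partition the box of stage `i`. -/
theorem card_boxIdx (hs : ∀ i, s.1 i < s.2 i) (i : Fin d) :
    (boxIdx s z i).card =
      (cellIdx s z (.inr (some (.inl i)))).card + (cellIdx s z (.inl (.inl i))).card +
        (boxIdx s z (i + 1)).card + (cellIdx s z (.inl (.inr i))).card +
        (cellIdx s z (.inr (some (.inr i)))).card := by
  rw [card_eq_add_filter _ (fun m => z m i) (s.2 i), card_filter_lt_eq_add hs, filter_boxIdx_eq',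
    filter_boxIdx_gt]

/-- The nesting condition enters only through this bound: enough points survive each stage for the
rank `u i` to exist. -/
theorem le_stageSize (hun : ∀ i, u i ≤ n)
    (hnest : ∀ i j : Fin d, (j : ℕ) = (i : ℕ) + 1 → 2 ≤ u j ∧ u j ≤ u i - l i - 1) (i : Fin d) :
    u i ≤ stageSize n l u i := by
  obtain ⟨k, hk⟩ := i
  cases k with
  | zero => exact hun _
  | succ k =>
    have := (hnest ⟨k, by omega⟩ ⟨k + 1, hk⟩ rfl).2
    simpa [stageSize, (by omega : k < d)] using this

/-- A rectangle with the right cell counts is the sequentially nested rectangle. -/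
theorem HasCellCounts.seqNest_eq (hl : ∀ i, 1 ≤ l i) (hlu : ∀ i, l i < u i)
    (hu : ∀ i : Fin d, u i ≤ stageSize n l u i) (h : HasCellCounts l u z s) :
    seqNest l u z = s := by
  obtain ⟨hs, hc⟩ := h
  -- Removing `l k - 1` points below, one on each face and `stageSize - u k` above leaves `u k - l k
  -- - 1`.
  have size (k : ℕ) (hk : k ≤ d) : (boxIdx s z k).card = stageSize n l u k := by
    induction k with
    | zero => simp [boxIdx_zero, stageSize]
    | succ k ih =>
      have h1 := card_boxIdx (z := z) hs ⟨k, hk⟩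
      have h2 := hu ⟨k, hk⟩
      have h3 := hl ⟨k, hk⟩
      have h4 := hlu ⟨k, hk⟩
      simp only [hc, cellCount, openCount, ih (by omega)] at h1 h2
      simp only [stageSize, dif_pos (show k < d by omega)]
      omega
  -- Below the upper face lie `(l i - 1) + 1 + (u i - l i - 1) = u i - 1` points, so the point on
  -- that face has rank `u i`.
  have stat (i : Fin d) : orderStat (boxIdx s z i) (fun r => z r i) (l i) = s.1 i ∧
      orderStat (boxIdx s z i) (fun r => z r i) (u i) = s.2 i := by
    have h1 := card_boxIdx (z := z) hs i
    have h2 := hu i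
    have h3 := hl i
    have h4 := hlu i
    simp only [hc, cellCount, openCount, size i i.2.le] at h1
    constructor <;> apply orderStat_eq_of_card
    · rw [filter_boxIdx_lt, hc]
      simp only [cellCount, openCount]
      omega
    · rw [card_filter_le_eq_add, filter_boxIdx_lt, filter_boxIdx_eq, hc, hc]
      simp only [cellCount, openCount]
      omega
    · rw [card_filter_lt_eq_add hs, hc, hc]
      simp only [cellCount, openCount]
      omega
    · rw [card_filter_le_eq_add, card_filter_lt_eq_add hs, filter_boxIdx_eq', hc, hc, hc]
      simp only [cellCount, openCount]
      omega
  have nest (k : ℕ) (hk : k ≤ d) : nestedIdx l u z k = boxIdx s z k := by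
    induction k with
    | zero => rw [boxIdx_zero, nestedIdx]
    | succ k ih =>
      have h2 := boxIdx_succ (s := s) (z := z) ⟨k, hk⟩
      have h3 := stat ⟨k, hk⟩
      simp only at h2 h3
      rw [nestedIdx, dif_pos (show k < d from hk), h2, ih (by omega), h3.1, h3.2]
  refine Prod.ext (funext fun i => ?_) (funext fun i => ?_)
  · simp only [seqNest, nest i i.2.le, (stat i).1]
  · simp only [seqNest, nest i i.2.le, (stat i).2]

/-- The cells of the sequentially nested rectangle of a sample without ties have the right
counts. -/
theorem hasCellCounts_seqNest (hl : ∀ i, 1 ≤ l i) (hlu : ∀ i, l i < u i)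
    (hu : ∀ i : Fin d, u i ≤ stageSize n l u i) (hz : ∀ i, Function.Injective fun m => z m i) :
    HasCellCounts l u z (seqNest l u z) := by
  set S := seqNest l u z with hS
  -- Conditional on the stage size, since the induction in `size` uses this at stage `k` to reach
  -- stage `k + 1`.
  have stat (i : Fin d) (hi : (boxIdx S z i).card = stageSize n l u i) :
      ((boxIdx S z i).filter (fun m => z m i < S.1 i)).card = l i - 1 ∧
      ((boxIdx S z i).filter (fun m => z m i = S.1 i)).card = 1 ∧
      ((boxIdx S z i).filter (fun m => z m i < S.2 i)).card = u i - 1 ∧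
      ((boxIdx S z i).filter (fun m => z m i = S.2 i)).card = 1 := by
    have h2 := hu i
    have h3 := hl i
    have h4 := hlu i
    have e1 : S.1 i = orderStat (boxIdx S z i) (fun r => z r i) (l i) := by
      rw [← nestedIdx_eq_boxIdx i i.2.le]; rfl
    have e2 : S.2 i = orderStat (boxIdx S z i) (fun r => z r i) (u i) := by
      rw [← nestedIdx_eq_boxIdx i i.2.le]; rfl
    have h5 := exists_eq_orderStat (A := boxIdx S z i) (hz i).injOn h3 (by omega)
    have h6 := exists_eq_orderStat (A := boxIdx S z i) (hz i).injOn (h3.trans h4.le) (by omega)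
    rw [← e1] at h5
    rw [← e2] at h6
    exact ⟨h5.1, h5.2, h6.1, h6.2⟩
  have lt (i : Fin d) (hi : (boxIdx S z i).card = stageSize n l u i) : S.1 i < S.2 i := by
    obtain ⟨h1, h2, h3, h4⟩ := stat i hi
    -- Otherwise the `u i - 1` points below `S.2 i` would be among the `l i - 1` points below `S.1
    -- i`.
    by_contra! hle
    have := Finset.card_le_card (Finset.monotone_filter_right (boxIdx S z i)
      (p := fun m => z m i < S.2 i) (q := fun m => z m i < S.1 i) fun m _ hm => hm.trans_le hle)
    have := hl i
    have := hlu i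
    omega
  have size (k : ℕ) (hk : k ≤ d) : (boxIdx S z k).card = stageSize n l u k := by
    induction k with
    | zero => simp [boxIdx_zero, stageSize]
    | succ k ih =>
      have hi := ih (by omega)
      obtain ⟨h1, h2, h3, h4⟩ := stat ⟨k, hk⟩ hi
      have h6 := boxIdx_succ (s := S) (z := z) ⟨k, hk⟩
      have h7 := card_eq_add_filter ((boxIdx S z k).filter (fun m => z m ⟨k, hk⟩ < S.2 ⟨k, hk⟩))
        (fun m => z m ⟨k, hk⟩) (S.1 ⟨k, hk⟩)
      have h8 := lt ⟨k, hk⟩ hi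
      simp only at h1 h2 h3 h4 h6
      have e1 : ((boxIdx S z k).filter (fun m => z m ⟨k, hk⟩ < S.2 ⟨k, hk⟩)).filter
          (fun m => z m ⟨k, hk⟩ < S.1 ⟨k, hk⟩) =
          (boxIdx S z k).filter (fun m => z m ⟨k, hk⟩ < S.1 ⟨k, hk⟩) :=
        filter_filter_of_imp _ fun m h => h.trans h8
      have e2 : ((boxIdx S z k).filter (fun m => z m ⟨k, hk⟩ < S.2 ⟨k, hk⟩)).filter
          (fun m => z m ⟨k, hk⟩ = S.1 ⟨k, hk⟩) =
          (boxIdx S z k).filter (fun m => z m ⟨k, hk⟩ = S.1 ⟨k, hk⟩) :=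
        filter_filter_of_imp _ fun m h => h.trans_lt h8
      have e3 : ((boxIdx S z k).filter (fun m => z m ⟨k, hk⟩ < S.2 ⟨k, hk⟩)).filter
          (fun m => S.1 ⟨k, hk⟩ < z m ⟨k, hk⟩) = boxIdx S z (k + 1) := by
        rw [Finset.filter_filter, h6]
        exact Finset.filter_congr fun m _ => and_comm
      rw [e1, e2, e3, h1, h2, h3] at h7
      have := hl ⟨k, hk⟩
      have := hlu ⟨k, hk⟩
      simp only [stageSize, dif_pos (show k < d by omega)]
      omega
  refine ⟨fun i => lt i (size i i.2.le), ?_⟩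
  rintro ((i | i) | _ | (i | i))
  · rw [← filter_boxIdx_eq, (stat i (size i i.2.le)).2.1]; rfl
  · rw [← filter_boxIdx_eq', (stat i (size i i.2.le)).2.2.2]; rfl
  · rw [← boxIdx_last, size d le_rfl]; rfl
  · rw [← filter_boxIdx_lt, (stat i (size i i.2.le)).1]; rfl
  · have h1 := card_eq_add_filter (boxIdx S z i) (fun m => z m i) (S.2 i)
    obtain ⟨-, -, h2, h3⟩ := stat i (size i i.2.le)
    have := hu i
    have := hlu i
    rw [size i i.2.le, h2, h3, filter_boxIdx_gt] at h1
    simp only [cellCount, openCount]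
    omega

end Cells

/-! ### Products of densities, kernels and disintegrations -/

section ProductMeasures

/-- **Tonelli's theorem** for a product of functions of finitely many variables. -/
theorem lintegral_fin_prod_eq_prod {n : ℕ} {E : Type*} [MeasurableSpace E]
    (μ : Fin n → Measure E) [∀ i, SigmaFinite (μ i)] {f : Fin n → E → ℝ≥0∞}
    (hf : ∀ i, Measurable (f i)) :
    ∫⁻ x, ∏ i, f i (x i) ∂(Measure.pi μ) = ∏ i, ∫⁻ x, f i x ∂(μ i) := by
  induction n with
  | zero => simp
  | succ n ih =>
    rw [← ((measurePreserving_piFinSuccAbove μ 0).symm).lintegral_comp_emb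
      (MeasurableEquiv.measurableEmbedding _)]
    simp only [MeasurableEquiv.piFinSuccAbove_symm_apply, Fin.insertNthEquiv, Fin.prod_univ_succ,
      Fin.insertNth_zero, Equiv.coe_fn_mk, Fin.cons_succ, Fin.zero_succAbove, Fin.cons_zero, cast_eq]
    refine (lintegral_prod_mul (f := f 0) (g := fun y : Fin n → E => ∏ i : Fin n, f i.succ (y i))
      (hf 0).aemeasurable (Finset.measurable_prod _ fun i _ =>
        (hf i.succ).comp (measurable_pi_apply i)).aemeasurable).trans ?_
    rw [ih (fun i => μ i.succ) fun i => hf i.succ]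

/-- **Tonelli's theorem** for a product of functions indexed by a finite type. -/
theorem lintegral_fintype_prod_eq_prod {ι : Type*} [Fintype ι] {E : Type*} [MeasurableSpace E]
    (μ : ι → Measure E) [∀ i, SigmaFinite (μ i)]
    {f : ι → E → ℝ≥0∞} (hf : ∀ i, Measurable (f i)) :
    ∫⁻ x, ∏ i, f i (x i) ∂(Measure.pi μ) = ∏ i, ∫⁻ x, f i x ∂(μ i) := by
  let e := (Fintype.equivFin ι).symm
  rw [← (measurePreserving_piCongrLeft _ e).lintegral_comp_emb
    (MeasurableEquiv.measurableEmbedding _)]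
  simp_rw [← e.prod_comp, MeasurableEquiv.coe_piCongrLeft, Equiv.piCongrLeft_apply_apply]
  exact lintegral_fin_prod_eq_prod (fun i => μ (e i)) fun i => hf (e i)

theorem pi_withDensity {ι : Type*} [Fintype ι] {E : Type*} [MeasurableSpace E]
    (μ : ι → Measure E) [∀ i, SigmaFinite (μ i)]
    {f : ι → E → ℝ≥0∞} (hf : ∀ i, Measurable (f i))
    [∀ i, SigmaFinite ((μ i).withDensity (f i))] :
    Measure.pi (fun i => (μ i).withDensity (f i)) =
      (Measure.pi μ).withDensity fun x => ∏ i, f i (x i) := by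
  refine Measure.pi_eq fun s hs => ?_
  rw [withDensity_apply _ (MeasurableSet.univ_pi hs), Measure.restrict_pi_pi,
    lintegral_fintype_prod_eq_prod _ hf]
  exact Finset.prod_congr rfl fun i _ => (withDensity_apply _ (hs i)).symm

variable {ι : Type*} [Fintype ι] {α β : Type*} [MeasurableSpace α]
  [MeasurableSpace β]

/-- The product of finitely many Markov kernels, each with its own source. -/
def piKernel (κ : ι → Kernel α β) [∀ i, IsMarkovKernel (κ i)] :
    Kernel (ι → α) (ι → β) where
  toFun s := Measure.pi fun i => κ i (s i)
  measurable' := by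
    refine Measurable.measure_of_isPiSystem_of_isProbabilityMeasure generateFrom_pi.symm
      isPiSystem_pi ?_
    rintro _ ⟨t, ht, rfl⟩
    simp only [Measure.pi_pi]
    exact Finset.measurable_prod _ fun i _ =>
      ((κ i).measurable_coe (ht i (Set.mem_univ i))).comp (measurable_pi_apply i)

instance (κ : ι → Kernel α β) [∀ i, IsMarkovKernel (κ i)] :
    IsMarkovKernel (piKernel κ) :=
  ⟨fun s => inferInstanceAs (IsProbabilityMeasure (Measure.pi fun i => κ i (s i)))⟩

/-- Both sides agree on boxes, where Tonelli factors the integral: drawing independent pairs amounts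
to drawing all first components, then all second ones independently given them. -/
theorem pi_compProd (ρ : ι → Measure α) [∀ i, IsProbabilityMeasure (ρ i)]
    (κ : ι → Kernel α β) [∀ i, IsMarkovKernel (κ i)] :
    Measure.pi (fun i => ρ i ⊗ₘ κ i) =
      (Measure.pi ρ ⊗ₘ piKernel κ).map fun p i => (p.1 i, p.2 i) := by
  have hm : Measurable fun (p : (ι → α) × (ι → β)) i => (p.1 i, p.2 i) := by fun_prop
  refine Measure.pi_eq fun s hs => ?_
  rw [Measure.map_apply hm (MeasurableSet.univ_pi hs),
    Measure.compProd_apply (hm (MeasurableSet.univ_pi hs))]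
  have (a : ι → α) : piKernel κ a (Prod.mk a ⁻¹'
      ((fun (p : (ι → α) × (ι → β)) i => (p.1 i, p.2 i)) ⁻¹' Set.univ.pi s)) =
      ∏ i, κ i (a i) (Prod.mk (a i) ⁻¹' s i) := by
    rw [← Measure.pi_pi]
    rfl
  simp_rw [this]
  rw [lintegral_fintype_prod_eq_prod (f := fun i a => κ i a (Prod.mk a ⁻¹' s i)) ρ
    fun i => Kernel.measurable_kernel_prodMk_left (hs i)]
  exact Finset.prod_congr rfl fun i _ => (Measure.compProd_apply (hs i)).symm

/-- Disintegration of a finite product of laws along one function of each variable. -/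
theorem lintegral_pi_condDistrib {Ω : Type*} [MeasurableSpace Ω]
    [StandardBorelSpace Ω] [Nonempty Ω] (μ : ι → Measure Ω)
    [∀ i, IsProbabilityMeasure (μ i)] {X : ι → Ω → α} (hX : ∀ i, Measurable (X i))
    {F : (ι → α) × (ι → Ω) → ℝ≥0∞} (hF : Measurable F) :
    ∫⁻ y, F (fun i => X i (y i), y) ∂(Measure.pi μ) =
      ∫⁻ s, ∫⁻ y, F (s, y) ∂(Measure.pi fun i => condDistrib (fun x => x) (X i) (μ i) (s i))
        ∂(Measure.pi fun i => (μ i).map (X i)) := by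
  have hprob (i : ι) : IsProbabilityMeasure ((μ i).map (X i)) :=
    Measure.isProbabilityMeasure_map (hX i).aemeasurable
  have h := pi_compProd (fun i => (μ i).map (X i)) fun i => condDistrib (fun x => x) (X i) (μ i)
  simp_rw [fun i : ι => compProd_map_condDistrib (μ := μ i) (X := X i) (Y := fun x => x)
    measurable_id.aemeasurable] at h
  have hp := measurePreserving_pi μ (fun i => (μ i).map fun a => (X i a, a))
    (f := fun i a => (X i a, a)) fun i => ⟨(hX i).prodMk measurable_id, rfl⟩
  have hG : Measurable fun w : ι → α × Ω => F (fun i => (w i).1, fun i => (w i).2) :=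
    hF.comp (by fun_prop)
  rw [hp.lintegral_comp hG, h, lintegral_map hG (by fun_prop), Measure.lintegral_compProd hF]
  rfl

end ProductMeasures

/-! ### Labelings of the sample points by cells -/

section Labelings

variable {d n : ℕ} {l u : Fin d → ℕ}

/-- The coordinate orthogonal to a face. -/
abbrev Face.axis : Face d → Fin d := Sum.elim id id

/-- The rectangle with faces at the given positions. -/
def rectOf (t : Face d → ℝ) : (Fin d → ℝ) × (Fin d → ℝ) :=
  (fun i => t (.inl i), fun i => t (.inr i))

/-- The rectangle spanned by one sample point on each face. -/
def spannedRect (w : Face d → Fin d → ℝ) : (Fin d → ℝ) × (Fin d → ℝ) :=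
  rectOf fun f => w f f.axis

/-- The places for the sample points in the cells of their sequentially nested rectangle. -/
abbrev Slot (n : ℕ) (l u : Fin d → ℕ) : Type :=
  Face d ⊕ Σ a : Option (Face d), Fin (openCount n l u a)

/-- The cell to which a place belongs. -/
def Slot.label : Slot n l u → CellLabel d := Sum.map id Sigma.fst

theorem Slot.card_label (a : CellLabel d) :
    Fintype.card {k : Slot n l u // k.label = a} = cellCount n l u a := by
  rcases a with f | a
  · refine Fintype.card_eq_one_iff.2 ⟨⟨.inl f, rfl⟩, ?_⟩
    rintro ⟨g | p, h⟩
    · exact Subtype.ext (congrArg Sum.inl (Sum.inl_injective h))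
    · exact absurd h (by simp [Slot.label])
  · let e : Fin (openCount n l u a) → {k : Slot n l u // k.label = .inr a} :=
      fun j => ⟨.inr ⟨a, j⟩, rfl⟩
    have he : Function.Bijective e := by
      refine ⟨fun i j h => ?_, ?_⟩
      · exact eq_of_heq (Sigma.mk.inj (Sum.inr_injective (congrArg Subtype.val h))).2
      rintro ⟨g | ⟨b, j⟩, h⟩
      · exact absurd h (by simp [Slot.label])
      · obtain rfl : b = a := Sum.inr_injective h
        exact ⟨j, rfl⟩
    rw [← Fintype.card_of_bijective he, Fintype.card_fin]
    rfl

/-- The sample points, put in the given places, lie in the cells of the nondegenerate rectangle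
that they span. -/
def Fits (y : Slot n l u → Fin d → ℝ) : Prop :=
  (∀ i, (spannedRect fun f => y (.inl f)).1 i < (spannedRect fun f => y (.inl f)).2 i) ∧
    ∀ k, y k ∈ cell (spannedRect fun f => y (.inl f)) k.label

theorem Fits.hasCellCounts {y : Slot n l u → Fin d → ℝ} (hy : Fits y) (e : Fin n ≃ Slot n l u) :
    HasCellCounts l u (fun m => y (e m)) (spannedRect fun f => y (.inl f)) := by
  classical
  refine ⟨hy.1, fun a => ?_⟩
  rw [← Slot.card_label (n := n) (l := l) (u := u) a, Fintype.card_subtype]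
  refine Finset.card_equiv e fun m => ?_
  rw [mem_cellIdx_iff, Finset.mem_filter]
  refine ⟨fun h => ⟨Finset.mem_univ _, cell_unique hy.1 (hy.2 _) h⟩, fun h => ?_⟩
  rw [← h.2]
  exact hy.2 _

/-- Over each cell, the points in it and its slots are equinumerous; bijections between these fibres
glue. -/
theorem HasCellCounts.exists_equiv {z : Fin n → Fin d → ℝ} {s : (Fin d → ℝ) × (Fin d → ℝ)}
    (h : HasCellCounts l u z s) :
    ∃ e : Fin n ≃ Slot n l u, ∀ m, z m ∈ cell s (e m).label := by
  classical
  choose φ hφ using fun m => exists_mem_cell s (z m)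
  have hcard (a : CellLabel d) :
      Nonempty ({m // φ m = a} ≃ {k : Slot n l u // k.label = a}) := by
    refine ⟨Fintype.equivOfCardEq ?_⟩
    rw [Slot.card_label, ← h.2 a, Fintype.card_subtype]
    congr 1
    ext m
    rw [mem_cellIdx_iff, Finset.mem_filter]
    refine ⟨fun hm => ?_, fun hm => ⟨Finset.mem_univ _, cell_unique h.1 (hφ m) hm⟩⟩
    rw [← hm.2]
    exact hφ m
  refine ⟨Equiv.ofFiberEquiv fun a => (hcard a).some, fun m => ?_⟩
  rw [Equiv.ofFiberEquiv_map (g := Slot.label)]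
  exact hφ m

theorem spannedRect_eq_of_mem_cell {z : Fin n → Fin d → ℝ} {s : (Fin d → ℝ) × (Fin d → ℝ)}
    {e : Fin n ≃ Slot n l u} (he : ∀ m, z m ∈ cell s (e m).label) :
    (spannedRect fun f => z (e.symm (.inl f))) = s := by
  refine Prod.ext (funext fun i => ?_) (funext fun i => ?_)
  · have := he (e.symm (.inl (.inl i)))
    rw [Equiv.apply_symm_apply] at this
    exact this.1
  · have := he (e.symm (.inl (.inr i)))
    rw [Equiv.apply_symm_apply] at this
    exact this.1

/-- The assignments of a cell to each sample point, with the right number of points per cell. -/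
abbrev Labeling (n : ℕ) (l u : Fin d → ℕ) : Type :=
  {φ : Fin n → CellLabel d // ∃ e : Fin n ≃ Slot n l u, ∀ m, (e m).label = φ m}

/-- An assignment of places compatible with the given labeling. -/
def Labeling.equiv (φ : Labeling n l u) : Fin n ≃ Slot n l u := φ.2.choose

theorem Labeling.label_equiv (φ : Labeling n l u) (m : Fin n) :
    (φ.equiv m).label = φ.1 m := φ.2.choose_spec m

instance : Finite (Labeling n l u) := Subtype.finite

instance : Fintype (Labeling n l u) := Fintype.ofFinite _

/-- The placed samples that fit and whose rectangle lies in `B`. -/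
def fitSet (n : ℕ) (l u : Fin d → ℕ) (B : Set ((Fin d → ℝ) × (Fin d → ℝ))) :
    Set (Slot n l u → Fin d → ℝ) :=
  {y | Fits y ∧ (spannedRect fun f => y (.inl f)) ∈ B}

/-- This makes the constant positive; any sample without ties serves as a witness. -/
theorem nonempty_labeling (hl : ∀ i, 1 ≤ l i) (hlu : ∀ i, l i < u i)
    (hu : ∀ i : Fin d, u i ≤ stageSize n l u i) : Nonempty (Labeling n l u) := by
  obtain ⟨e, -⟩ := (hasCellCounts_seqNest (z := fun (m : Fin n) (_ : Fin d) => (m : ℝ)) hl hlu hu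
    fun i a b h => Fin.ext (Nat.cast_injective (R := ℝ) h)).exists_equiv
  exact ⟨fun m => (e m).label, e, fun m => rfl⟩

/-- A sample without ties fits exactly one labeling. -/
theorem sum_indicator_fitSet (hl : ∀ i, 1 ≤ l i) (hlu : ∀ i, l i < u i)
    (hu : ∀ i : Fin d, u i ≤ stageSize n l u i) (B : Set ((Fin d → ℝ) × (Fin d → ℝ)))
    {z : Fin n → Fin d → ℝ} (hz : ∀ i, Function.Injective fun m => z m i) :
    ∑ φ : Labeling n l u,
        (fitSet n l u B).indicator (1 : (Slot n l u → Fin d → ℝ) → ℝ≥0∞)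
          (fun k => z (φ.equiv.symm k)) =
      B.indicator 1 (seqNest l u z) := by
  have hc := hasCellCounts_seqNest hl hlu hu hz
  obtain ⟨e, he⟩ := hc.exists_equiv
  let φ : Labeling n l u := ⟨fun m => (e m).label, e, fun m => rfl⟩
  have hφ (m) : z m ∈ cell (seqNest l u z) (φ.equiv m).label := by
    rw [φ.label_equiv]
    exact he m
  have hs := spannedRect_eq_of_mem_cell hφ
  rw [Finset.sum_eq_single φ]
  · have hfit : Fits fun k => z (φ.equiv.symm k) := by
      refine ⟨?_, fun k => ?_⟩
      · rw [hs]
        exact hc.1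
      · rw [hs]
        simpa using hφ (φ.equiv.symm k)
    by_cases hB : seqNest l u z ∈ B
    · rw [Set.indicator_of_mem hB, Set.indicator_of_mem (show _ ∈ fitSet n l u B from
        ⟨hfit, show _ ∈ B by rwa [hs]⟩)]
      rfl
    · rw [Set.indicator_of_notMem hB, Set.indicator_of_notMem]
      rintro ⟨-, h⟩
      rw [hs] at h
      exact hB h
  -- Another fitting labeling also spans the nested rectangle, so disjointness of cells forces it to
  -- equal `φ`. Bijections with slots would not be unique, as points within an open cell can be
  -- permuted.
  · intro ψ _ hψ
    refine Set.indicator_of_notMem (fun h => hψ ?_) _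
    have h1 := h.1.hasCellCounts ψ.equiv
    simp only [Equiv.symm_apply_apply] at h1
    have h2 := h1.seqNest_eq hl hlu hu
    refine Subtype.ext (funext fun m => ?_)
    rw [← ψ.label_equiv, ← φ.label_equiv]
    have h3 := h.1.2 (ψ.equiv m)
    rw [← h2] at h3
    simp only [Equiv.symm_apply_apply] at h3
    exact cell_unique hc.1 h3 (hφ m)
  · exact fun h => absurd (Finset.mem_univ _) h

end Labelings

/-! ### Measurability in the rectangle -/

section Measurability

variable {d n : ℕ} {l u : Fin d → ℕ}

theorem measurable_spannedRect : Measurable (spannedRect (d := d)) := by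
  unfold spannedRect rectOf
  fun_prop

theorem measurableSet_earlierBox (i : Fin d) :
    MeasurableSet {p : ((Fin d → ℝ) × (Fin d → ℝ)) × (Fin d → ℝ) | p.2 ∈ earlierBox p.1 i} := by
  simp only [earlierBox, Set.mem_ofPred_eq]
  measurability

theorem measurableSet_cell (a : CellLabel d) :
    MeasurableSet {p : ((Fin d → ℝ) × (Fin d → ℝ)) × (Fin d → ℝ) | p.2 ∈ cell p.1 a} := by
  rcases a with (i | i) | _ | (i | i)
  · exact (measurableSet_eq_fun (by fun_prop) (by fun_prop)).inter (measurableSet_earlierBox i)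
  · exact (measurableSet_eq_fun (by fun_prop) (by fun_prop)).inter (measurableSet_earlierBox i)
  · simp only [cell, Set.mem_ofPred_eq]
    measurability
  · exact (measurableSet_lt (by fun_prop) (by fun_prop)).inter (measurableSet_earlierBox i)
  · exact (measurableSet_lt (by fun_prop) (by fun_prop)).inter (measurableSet_earlierBox i)

theorem measurableSet_nondegenerate :
    MeasurableSet {s : (Fin d → ℝ) × (Fin d → ℝ) | ∀ i, s.1 i < s.2 i} := by
  measurability

theorem measurableSet_fitSet {B : Set ((Fin d → ℝ) × (Fin d → ℝ))} (hB : MeasurableSet B) :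
    MeasurableSet (fitSet n l u B) := by
  have hr : Measurable fun y : Slot n l u → Fin d → ℝ => spannedRect fun f => y (.inl f) :=
    measurable_spannedRect.comp (by fun_prop)
  have hc : MeasurableSet {y : Slot n l u → Fin d → ℝ |
      ∀ k, y k ∈ cell (spannedRect fun f => y (.inl f)) k.label} := by
    rw [Set.ofPred_forall]
    exact MeasurableSet.iInter fun k =>
      (hr.prodMk (measurable_pi_apply k)) (measurableSet_cell k.label)
  exact ((hr measurableSet_nondegenerate).inter hc).inter (hr hB)

variable (μ : Measure (Fin d → ℝ))

theorem measurable_measure_cell [SFinite μ] (a : CellLabel d) : Measurable fun s => μ (cell s a) :=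
  measurable_measure_prodMk_left (measurableSet_cell a)

/-- Both the event and the conditioning value vary with `s`; pulling the kernel back along `t`
reduces this to measurable sections of a jointly measurable set. -/
theorem measurable_condEarlier [IsFiniteMeasure μ] (i : Fin d) {t : (Fin d → ℝ) × (Fin d → ℝ) → ℝ}
    (ht : Measurable t) : Measurable fun s => condEarlier μ s i (t s) :=
  Kernel.measurable_kernel_prodMk_left
    (κ := (condDistrib (fun x : Fin d → ℝ => x) (fun x => x i) μ).comap t ht)
    (measurableSet_earlierBox i)

theorem measurable_margDens (i : Fin d) : Measurable (margDens μ i) :=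
  measurable_pdf (fun x : Fin d → ℝ => x i) μ volume

end Measurability

/-- A proper subspace is Haar-null. Applied to differences of coordinates, this excludes ties and
degenerate rectangles. -/
theorem ae_linearMap_ne_zero {E : Type*} [NormedAddCommGroup E] [NormedSpace ℝ E]
    [MeasurableSpace E] [BorelSpace E] [FiniteDimensional ℝ E] (μ : Measure E) [μ.IsAddHaarMeasure]
    (φ : E →ₗ[ℝ] ℝ) (hφ : ∃ x, φ x ≠ 0) : ∀ᵐ x ∂μ, φ x ≠ 0 := by
  have h : φ.ker ≠ ⊤ := fun h => by
    obtain ⟨x, hx⟩ := hφ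
    exact hx (LinearMap.mem_ker.1 (h ▸ Submodule.mem_top))
  rw [ae_iff]
  simp only [not_not]
  exact Measure.addHaar_submodule μ φ.ker h

/-! ### The contribution of one labeling -/

section Likelihood

variable {d n : ℕ} {l u : Fin d → ℕ}

theorem stageSize_eq_sub (i : Fin d) (hi : (i : ℕ) ≠ 0) :
    stageSize n l u i = u ⟨i - 1, by omega⟩ - l ⟨i - 1, by omega⟩ - 1 := by
  obtain ⟨k, hk⟩ := i
  cases k with
  | zero => exact absurd rfl hi
  | succ k => simp [stageSize, show k < d by omega]

theorem openCount_upper [NeZero d] (i : Fin d) (hi : i ≠ 0) :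
    openCount n l u (some (.inr i)) = u (i - 1) - u i - l (i - 1) - 1 := by
  obtain ⟨d, rfl⟩ := Nat.exists_eq_succ_of_ne_zero (NeZero.ne d)
  have h0 : (i : ℕ) ≠ 0 := fun h => hi (Fin.ext h)
  have h1 : (⟨i - 1, by omega⟩ : Fin (d + 1)) = i - 1 := by
    refine Fin.ext ?_
    rw [Fin.coe_sub_one, if_neg hi]
  rw [openCount, stageSize_eq_sub i h0, h1]
  omega

theorem openCount_upper_zero [NeZero d] : openCount n l u (some (.inr 0)) = n - u 0 := by
  obtain ⟨d, rfl⟩ := Nat.exists_eq_succ_of_ne_zero (NeZero.ne d)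
  rfl

theorem openCount_none [NeZero d] : openCount n l u none = u ⊤ - l ⊤ - 1 := by
  obtain ⟨d, rfl⟩ := Nat.exists_eq_succ_of_ne_zero (NeZero.ne d)
  simp only [openCount, stageSize, dif_pos (Nat.lt_succ_self d)]
  rfl

variable (μ : Measure (Fin d → ℝ)) [IsProbabilityMeasure μ]

/-- The probability that the sample points put in the open cells of `s` lie in these cells. -/
def openCellsProb (n : ℕ) (l u : Fin d → ℕ) (s : (Fin d → ℝ) × (Fin d → ℝ)) : ℝ≥0∞ :=
  ∏ a, μ (cell s (.inr a)) ^ openCount n l u a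

/-- No coordinate precedes the first, so its faces fit the same product formula as all others. -/
theorem condEarlier_zero [NeZero d] (s : (Fin d → ℝ) × (Fin d → ℝ)) (t : ℝ) :
    condEarlier μ s 0 t = 1 := by
  have : earlierBox s 0 = Set.univ :=
    Set.eq_univ_of_forall fun x j hj => absurd hj (Fin.not_lt_zero j)
  rw [condEarlier, this, measure_univ]

/-- The likelihood as a product over faces and open cells. -/
theorem seqNestLik_rectOf [NeZero d] (t : Face d → ℝ) :
    seqNestLik μ n l u (rectOf t) = openCellsProb μ n l u (rectOf t) *
      (∏ f : Face d, condEarlier μ (rectOf t) f.axis (t f)) *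
        ∏ f : Face d, margDens μ f.axis (t f) := by
  set s := rectOf t
  have hbox : earlierBox s 0 = Set.univ :=
    Set.eq_univ_of_forall fun x j hj => absurd hj (Fin.not_lt_zero j)
  have hfull : ∏ i : Fin d,
      ((condEarlier μ s i (s.1 i) * margDens μ i (s.1 i) *
          μ (cell s (.inr (some (.inl i)))) ^ openCount n l u (some (.inl i))) *
        (condEarlier μ s i (s.2 i) * margDens μ i (s.2 i) *
          μ (cell s (.inr (some (.inr i)))) ^ openCount n l u (some (.inr i)))) =
      margDens μ 0 (s.1 0) * margDens μ 0 (s.2 0) *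
        ∏ i : Fin d, pTerm μ l s i * qTerm μ n l u s i := by
    rw [← Finset.mul_prod_erase _ _ (Finset.mem_univ (0 : Fin d)),
      ← Finset.mul_prod_erase _ _ (Finset.mem_univ (0 : Fin d)),
      ← mul_assoc (margDens μ 0 (s.1 0) * margDens μ 0 (s.2 0))]
    congr 1
    · rw [pTerm, qTerm, if_pos rfl, if_pos rfl, condEarlier_zero, condEarlier_zero,
        openCount_upper_zero]
      simp only [cell, hbox, Set.inter_univ, openCount]
      ring
    · refine Finset.prod_congr rfl fun i hi => ?_
      have hi0 := Finset.ne_of_mem_erase hi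
      rw [pTerm, qTerm, if_neg hi0, if_neg hi0, openCount_upper i hi0]
      rfl
  rw [seqNestLik, mul_assoc, mul_assoc, ← mul_assoc (margDens μ 0 _), ← hfull, openCellsProb,
    Fintype.prod_option, Fintype.prod_sum_type, Fintype.prod_sum_type, Fintype.prod_sum_type,
    openCount_none]
  simp only [Finset.prod_mul_distrib]
  change μ (cell s (.inr none)) ^ _ * _ = _
  simp only [Sum.elim_inl, Sum.elim_inr, id]
  change _ = _ * ((∏ i, condEarlier μ s i (s.1 i)) * ∏ i, condEarlier μ s i (s.2 i)) *
    ((∏ i, margDens μ i (s.1 i)) * ∏ i, margDens μ i (s.2 i))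
  ring

theorem measurable_openCellsProb : Measurable (openCellsProb μ n l u) :=
  Finset.measurable_prod _ fun _ _ => (measurable_measure_cell μ _).pow_const _

theorem measurable_rectOf : Measurable (rectOf (d := d)) := by
  unfold rectOf
  fun_prop

theorem measurePreserving_rectOf :
    MeasurePreserving (rectOf (d := d)) volume volume :=
  volume_measurePreserving_sumPiEquivProdPi fun _ : Face d => ℝ

theorem measurable_seqNestLik [NeZero d] : Measurable (seqNestLik μ n l u) := by
  have h : seqNestLik μ n l u = fun s => openCellsProb μ n l u s *
      (∏ f : Face d, condEarlier μ s f.axis (Sum.elim s.1 s.2 f)) *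
        ∏ f : Face d, margDens μ f.axis (Sum.elim s.1 s.2 f) :=
    funext fun s => seqNestLik_rectOf μ (Sum.elim s.1 s.2)
  have hf (f : Face d) :
      Measurable fun s : (Fin d → ℝ) × (Fin d → ℝ) => (Sum.elim s.1 s.2 f : ℝ) := by
    rcases f with i | i <;> simp only [Sum.elim_inl, Sum.elim_inr] <;> fun_prop
  rw [h]
  exact ((measurable_openCellsProb μ).mul (Finset.measurable_prod _ fun f _ =>
    measurable_condEarlier μ f.axis (hf f))).mul
    (Finset.measurable_prod _ fun f _ => (measurable_margDens μ f.axis).comp (hf f))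

theorem map_eval_eq_withDensity (hμ : μ ≪ volume) (i : Fin d) :
    μ.map (fun x => x i) = volume.withDensity (margDens μ i) := by
  have hac : μ.map (fun x => x i) ≪ volume :=
    (hμ.map (measurable_pi_apply i)).trans
      (Measure.quasiMeasurePreserving_eval
        (fun _ : Fin d => (volume : Measure ℝ)) i).absolutelyContinuous
  have : HasPDF (fun x : Fin d → ℝ => x i) μ volume :=
    (Real.hasPDF_iff_of_aemeasurable (measurable_pi_apply i).aemeasurable).2 hac
  exact map_eq_withDensity_pdf _ _ _

/-- Integrating out the sample points that are not on a face. -/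
theorem pi_fitSet_eq_lintegral {B : Set ((Fin d → ℝ) × (Fin d → ℝ))} (hB : MeasurableSet B) :
    Measure.pi (fun _ : Slot n l u => μ) (fitSet n l u B) =
      ∫⁻ w : Face d → Fin d → ℝ,
        (B ∩ {s | ∀ i, s.1 i < s.2 i}).indicator (openCellsProb μ n l u) (spannedRect w) *
        (Set.univ.pi fun f : Face d => earlierBox (spannedRect w) f.axis).indicator 1 w
        ∂(Measure.pi fun _ => μ) := by
  have hm := measurableSet_fitSet (n := n) (l := l) (u := u) hB
  have hp := measurePreserving_sumPiEquivProdPi_symm (X := fun _ : Slot n l u => Fin d → ℝ)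
    fun _ => μ
  rw [← hp.measure_preimage hm.nullMeasurableSet, Measure.prod_apply (hp.measurable hm)]
  refine lintegral_congr fun w => ?_
  by_cases h1 : spannedRect w ∈ B ∩ {s | ∀ i, s.1 i < s.2 i}
  · by_cases h2 : w ∈ Set.univ.pi fun f : Face d => earlierBox (spannedRect w) f.axis
    · rw [Set.indicator_of_mem h1, Set.indicator_of_mem h2, Pi.one_apply, mul_one]
      -- Once admissible face points are fixed, fitting constrains each remaining point separately,
      -- so the section is a box.
      have : Prod.mk w ⁻¹' ((MeasurableEquiv.sumPiEquivProdPi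
          fun _ : Slot n l u => Fin d → ℝ).symm ⁻¹' fitSet n l u B) =
          Set.univ.pi fun j => cell (spannedRect w) (.inr j.1) := by
        ext v
        refine ⟨fun hv j _ => hv.1.2 (.inr j), fun hv => ⟨⟨h1.2, ?_⟩, h1.1⟩⟩
        rintro ((i | i) | j)
        · exact ⟨rfl, h2 (.inl i) (Set.mem_univ _)⟩
        · exact ⟨rfl, h2 (.inr i) (Set.mem_univ _)⟩
        · exact hv j (Set.mem_univ _)
      rw [this, Measure.pi_pi, Fintype.prod_sigma]
      simp [openCellsProb]
    · rw [Set.indicator_of_notMem h2, mul_zero]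
      refine measure_mono_null (fun v hv => h2 ?_) measure_empty
      rintro (i | i) -
      · exact (hv.1.2 (.inl (.inl i))).2
      · exact (hv.1.2 (.inl (.inr i))).2
  · rw [Set.indicator_of_notMem h1, zero_mul]
    exact measure_mono_null (fun v hv => h1 ⟨hv.2, hv.1.1⟩) measure_empty

theorem pi_fitSet [NeZero d] (hμ : μ ≪ volume) {B : Set ((Fin d → ℝ) × (Fin d → ℝ))}
    (hB : MeasurableSet B) :
    Measure.pi (fun _ : Slot n l u => μ) (fitSet n l u B) =
      ∫⁻ s in B ∩ rectSpace d, seqNestLik μ n l u s := by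
  set D := (B ∩ {s | ∀ i, s.1 i < s.2 i}).indicator (openCellsProb μ n l u) with hD
  have hBm := hB.inter (measurableSet_nondegenerate (d := d))
  have hDm : Measurable D := (measurable_openCellsProb μ).indicator hBm
  -- Face positions `p.1` are decoupled from face points `p.2`; the disintegration ties each
  -- position to the axis coordinate of its point.
  let F : (Face d → ℝ) × (Face d → Fin d → ℝ) → ℝ≥0∞ := fun p =>
    D (rectOf p.1) * (Set.univ.pi fun f : Face d => earlierBox (rectOf p.1) f.axis).indicator 1 p.2
  have hF : Measurable F := by
    refine (hDm.comp (measurable_rectOf.comp measurable_fst)).mul ?_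
    have : MeasurableSet {p : (Face d → ℝ) × (Face d → Fin d → ℝ) |
        p.2 ∈ Set.univ.pi fun f : Face d => earlierBox (rectOf p.1) f.axis} := by
      simp only [Set.mem_univ_pi]
      rw [Set.ofPred_forall]
      refine MeasurableSet.iInter fun f => ?_
      have hm : Measurable fun p : (Face d → ℝ) × (Face d → Fin d → ℝ) => (rectOf p.1, p.2 f) :=
        (measurable_rectOf.comp measurable_fst).prodMk (by fun_prop)
      exact hm (measurableSet_earlierBox f.axis)
    exact measurable_one.indicator this
  have hdens (f : Face d) : IsProbabilityMeasure (volume.withDensity (margDens μ f.axis)) := by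
    rw [← map_eval_eq_withDensity μ hμ]
    exact Measure.isProbabilityMeasure_map (measurable_pi_apply _).aemeasurable
  have hdis := lintegral_pi_condDistrib (fun _ : Face d => μ)
    (X := fun f x => x f.axis) (fun f => measurable_pi_apply _) hF
  simp_rw [map_eval_eq_withDensity μ hμ] at hdis
  rw [pi_withDensity _ fun f : Face d => measurable_margDens μ f.axis] at hdis
  rw [pi_fitSet_eq_lintegral μ hB]
  refine hdis.trans ?_
  have hinner (t : Face d → ℝ) : ∫⁻ y, F (t, y) ∂(Measure.pi fun f : Face d =>
        condDistrib (fun x => x) (fun x : Fin d → ℝ => x f.axis) μ (t f)) =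
      D (rectOf t) * ∏ f : Face d, condEarlier μ (rectOf t) f.axis (t f) := by
    have hbm : MeasurableSet (Set.univ.pi fun f : Face d => earlierBox (rectOf t) f.axis) :=
      MeasurableSet.univ_pi fun f => measurable_prodMk_left (measurableSet_earlierBox f.axis)
    simp only [F]
    rw [lintegral_const_mul _ (measurable_one.indicator hbm), lintegral_indicator_one hbm,
      Measure.pi_pi]
    rfl
  simp_rw [hinner]
  have hmt : Measurable fun t : Face d → ℝ =>
      ∏ f : Face d, condEarlier μ (rectOf t) f.axis (t f) := by
    refine Finset.measurable_prod _ fun f _ => ?_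
    exact Kernel.measurable_kernel_prodMk_left
      (κ := (condDistrib (fun x : Fin d → ℝ => x) (fun x => x f.axis) μ).comap
        (fun t : Face d → ℝ => t f) (measurable_pi_apply f))
      ((measurable_rectOf.prodMap measurable_id) (measurableSet_earlierBox f.axis))
  refine (lintegral_withDensity_eq_lintegral_mul _ (Finset.measurable_prod _ fun f _ =>
    (measurable_margDens μ f.axis).comp (measurable_pi_apply f))
    ((hDm.comp measurable_rectOf).mul hmt)).trans ?_
  have hlik (t : Face d → ℝ) :
      (B ∩ {s | ∀ i, s.1 i < s.2 i}).indicator (seqNestLik μ n l u) (rectOf t) =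
      (∏ f : Face d, margDens μ f.axis (t f)) *
        (D (rectOf t) * ∏ f : Face d, condEarlier μ (rectOf t) f.axis (t f)) := by
    by_cases h : rectOf t ∈ B ∩ {s | ∀ i, s.1 i < s.2 i}
    · rw [hD, Set.indicator_of_mem h, Set.indicator_of_mem h, seqNestLik_rectOf]
      ring
    · rw [hD, Set.indicator_of_notMem h, Set.indicator_of_notMem h, zero_mul, mul_zero]
  -- `rectSpace d` also admits degenerate rectangles, which form a null set.
  have hae : (B ∩ {s | ∀ i, s.1 i < s.2 i} : Set ((Fin d → ℝ) × (Fin d → ℝ)))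
      =ᵐ[volume] (B ∩ rectSpace d : Set _) := by
    refine (Filter.EventuallyEq.refl _ B).inter ?_
    have hne : ∀ᵐ s : (Fin d → ℝ) × (Fin d → ℝ), ∀ i, s.1 i ≠ s.2 i := by
      have : (volume : Measure ((Fin d → ℝ) × (Fin d → ℝ))).IsAddHaarMeasure :=
        Measure.prod.instIsAddHaarMeasure _ _
      refine ae_all_iff.2 fun i => ?_
      filter_upwards [ae_linearMap_ne_zero volume
        (LinearMap.proj i ∘ₗ LinearMap.fst ℝ (Fin d → ℝ) (Fin d → ℝ) - LinearMap.proj i ∘ₗ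
          LinearMap.snd ℝ (Fin d → ℝ) (Fin d → ℝ)) ⟨(1, 0), by simp⟩] with s hs
      exact sub_ne_zero.1 hs
    filter_upwards [hne] with s hs
    exact propext ⟨fun h i => (h i).le, fun h i => (h i).lt_of_ne (hs i)⟩
  rw [← setLIntegral_congr hae, ← lintegral_indicator hBm,
    ← measurePreserving_rectOf.lintegral_comp ((measurable_seqNestLik μ).indicator hBm)]
  simp only [hlik]
  rfl

end Likelihood

end

/-! ### Absence of ties and summation over labelings -/

theorem ae_injective_coordinate (d n : ℕ) :
    ∀ᵐ z : Fin n → Fin d → ℝ, ∀ i, Function.Injective fun m => z m i := by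
  have h : ∀ᵐ z : Fin n → Fin d → ℝ, ∀ (i : Fin d) (a b : Fin n), a ≠ b → z a i ≠ z b i := by
    refine ae_all_iff.2 fun i => ae_all_iff.2 fun a => ae_all_iff.2 fun b => ?_
    by_cases hab : a = b
    · simp [hab]
    let ev (c : Fin n) : (Fin n → Fin d → ℝ) →ₗ[ℝ] ℝ :=
      LinearMap.proj (R := ℝ) (φ := fun _ : Fin d => ℝ) i ∘ₗ
        LinearMap.proj (R := ℝ) (φ := fun _ : Fin n => Fin d → ℝ) c
    filter_upwards [ae_linearMap_ne_zero volume (ev a - ev b)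
      ⟨fun c _ => if c = a then 1 else 0, by simp [ev, Ne.symm hab]⟩] with z hz _
    exact sub_ne_zero.1 hz
  filter_upwards [h] with z hz i a b hab
  by_contra hne
  exact hz i a b hne hab

theorem lemma3 {Θ : Type*} {d n : ℕ} [NeZero d] (l u : Fin d → ℕ)
    (hl : ∀ i, 1 ≤ l i) (hlu : ∀ i, l i < u i) (hun : ∀ i, u i ≤ n)
    (hnest : ∀ i j : Fin d, (j : ℕ) = (i : ℕ) + 1 → 2 ≤ u j ∧ u j ≤ u i - l i - 1) :
    ∃ C : ℝ≥0, 0 < C ∧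
      ∀ (g : Θ → (Fin d → ℝ) → ℝ) (μ : Θ → Measure (Fin d → ℝ))
        [∀ θ, IsProbabilityMeasure (μ θ)],
        (∀ θ, Measurable (g θ)) → (∀ θ x, 0 ≤ g θ x) →
        (∀ θ, μ θ = volume.withDensity (fun x => ENNReal.ofReal (g θ x))) →
        ∀ θ, IsSymbolicLikelihood (seqNest (n := n) l u) (rectSpace d)
          (fun z : Fin n → Fin d → ℝ => ENNReal.ofReal (∏ k, g θ (z k)))
          (fun s => (C : ℝ≥0∞) * seqNestLik (μ θ) n l u s) := by
  have hu := le_stageSize hun hnest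
  have := nonempty_labeling hl hlu hu
  -- The number of labelings is the multinomial coefficient of the cell counts.
  refine ⟨Fintype.card (Labeling n l u), by exact_mod_cast Fintype.card_pos, ?_⟩
  intro g μ _ hg hg0 hμ θ
  refine ⟨(measurable_seqNestLik (μ θ)).const_mul _, fun B hB => ?_⟩
  have hgm : Measurable fun x => ENNReal.ofReal (g θ x) := (hg θ).ennreal_ofReal
  have hprob : IsProbabilityMeasure (volume.withDensity fun x => ENNReal.ofReal (g θ x)) :=
    hμ θ ▸ inferInstance
  have hpi : Measure.pi (fun _ : Fin n => μ θ) =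
      volume.withDensity fun z => ENNReal.ofReal (∏ k, g θ (z k)) := by
    simp_rw [ENNReal.ofReal_prod_of_nonneg fun k _ => hg0 θ _, hμ θ]
    exact pi_withDensity (fun _ => volume) fun _ => hgm
  have hdens : Measurable fun z : Fin n → Fin d → ℝ => ENNReal.ofReal (∏ k, g θ (z k)) :=
    (Finset.measurable_prod _ fun k _ => (hg θ).comp (measurable_pi_apply k)).ennreal_ofReal
  have hfit := measurableSet_fitSet (n := n) (l := l) (u := u) hB
  have hind (φ : Labeling n l u) : Measurable fun z : Fin n → Fin d → ℝ =>
      (fitSet n l u B).indicator (1 : (Slot n l u → Fin d → ℝ) → ℝ≥0∞)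
        (fun k => z (φ.equiv.symm k)) :=
    (measurable_one.indicator hfit).comp (by fun_prop)
  -- Reindexing by `φ.equiv` preserves the i.i.d. law, so the value does not depend on `φ`.
  have hterm (φ : Labeling n l u) : ∫⁻ z : Fin n → Fin d → ℝ,
      (fitSet n l u B).indicator (1 : (Slot n l u → Fin d → ℝ) → ℝ≥0∞)
        (fun k => z (φ.equiv.symm k)) ∂(Measure.pi fun _ => μ θ) =
      ∫⁻ s in B ∩ rectSpace d, seqNestLik (μ θ) n l u s := by
    rw [← pi_fitSet (μ θ) (hμ θ ▸ withDensity_absolutelyContinuous _ _) hB,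
      ← lintegral_indicator_one hfit,
      ← (measurePreserving_piCongrLeft (fun _ : Slot n l u => μ θ) φ.equiv).lintegral_comp
        (measurable_one.indicator hfit)]
    refine lintegral_congr fun z => congrArg _ (funext fun k => ?_)
    obtain ⟨m, rfl⟩ := φ.equiv.surjective k
    rw [Equiv.symm_apply_apply]
    exact (Equiv.piCongrLeft_apply_apply (fun _ => Fin d → ℝ) φ.equiv z m).symm
  have hsum : ∫⁻ z : Fin n → Fin d → ℝ,
      Measure.dirac (seqNest l u z) B * ENNReal.ofReal (∏ k, g θ (z k)) =
      ∫⁻ z, ∑ φ : Labeling n l u,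
        (fitSet n l u B).indicator (1 : (Slot n l u → Fin d → ℝ) → ℝ≥0∞)
          (fun k => z (φ.equiv.symm k)) ∂(Measure.pi fun _ => μ θ) := by
    rw [hpi, lintegral_withDensity_eq_lintegral_mul _ hdens
      (Finset.measurable_sum _ fun φ _ => hind φ)]
    refine lintegral_congr_ae ?_
    -- Off the ties, the Dirac term equals the measurable sum over labelings, so measurability of
    -- `seqNest` is never needed.
    filter_upwards [ae_injective_coordinate d n] with z hz
    rw [Pi.mul_apply, sum_indicator_fitSet hl hlu hu B hz, Measure.dirac_apply' _ hB, mul_comm]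
  rw [hsum, lintegral_finsetSum _ fun φ _ => hind φ, Finset.sum_congr rfl fun φ _ => hterm φ,
    lintegral_const_mul _ (measurable_seqNestLik (μ θ)), Finset.sum_const, Finset.card_univ,
    nsmul_eq_mul]
  simp
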